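/- Let $d,t\ge 0$ be integers, let $h_1,\dots,h_t\in\mathbb{R}^d$ be vectors such that the additive subgroup $h_1\mathbb{Z}+\cdots+h_t\mathbb{Z}$ is dense in $\mathbb{R}^d$, and let $m_1,\dots,m_t\ge 0$ be integers. For $f:\mathbb{R}^d\to\mathbb{C}$, $h\in\mathbb{R}^d$ and an integer $m\ge 0$ put $(\Delta_h^m f)(x)=\sum_{j=0}^{m}(-1)^{m-j}\binom{m}{j}f(x+jh)$, and similarly for test functions; for a complex-valued Schwartz distribution $T\in\mathcal{D}'(\mathbb{R}^d)$ put $(\Delta_h^m T)\{\varphi\}=T\{\Delta_{-h}^m\varphi\}$ for every test function $\varphi$. A continuous exponential polynomial on $\mathbb{R}^d$ is a function of the form $x\mapsto\sum_{j=1}^{n}p_j(x)\,e^{\langle\lambda_j,x\rangle}$ with $n\ge 0$, $p_j\in\mathbb{C}[x_1,\dots,x_d]$, $\lambda_j\in\mathbb{C}^d$ and $\langle\lambda,x\rangle=\sum_i\lambda_i x_i$. A distribution $T$ is said to be a continuous exponential polynomial if there is such a function $g$ with $T\{\varphi\}=\int_{\mathbb{R}^d}\varphi(x)g(x)\,dx$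 for every test function $\varphi$. Then: (a) if $f:\mathbb{R}^d\to\mathbb{C}$ is continuous and $\Delta_{h_k}^{m_k}f$ is a continuous exponential polynomial for every $k\in\{1,\dots,t\}$, then $f$ is a continuous exponential polynomial; (b) if $T\in\mathcal{D}'(\mathbb{R}^d)$ is a complex-valued distribution and $\Delta_{h_k}^{m_k}T$ is a continuous exponential polynomial (as a distribution) for every $k\in\{1,\dots,t\}$, then $T$ is a continuous exponential polynomial (as a distribution). -/

import Mathlib

open TopologicalSpace MeasureTheory
open scoped Distributions

namespace ExpPolyDiff

/-- Euclidean space `ℝ^d`. -/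
abbrev Eucl (d : ℕ) : Type := EuclideanSpace ℝ (Fin d)

/-- A continuous exponential polynomial on `ℝ^d`: a finite sum of products `p(x) * e^{⟨λ, x⟩}` with
`p` a complex polynomial in `d` variables and `λ ∈ ℂ^d`. The empty sum (the zero function) is
allowed. -/
def IsExpPoly {d : ℕ} (f : Eucl d → ℂ) : Prop :=
  ∃ (n : ℕ) (p : Fin n → MvPolynomial (Fin d) ℂ) (lam : Fin n → Fin d → ℂ),
    ∀ x : Eucl d, f x = ∑ j : Fin n,
      MvPolynomial.eval (fun i => (x i : ℂ)) (p j) * Complex.exp (∑ i : Fin d, lam j i * (x i : ℂ))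

/-- Exponential polynomials in the above sense are automatically continuous. -/
theorem IsExpPoly.continuous {d : ℕ} {f : Eucl d → ℂ} (hf : IsExpPoly f) : Continuous f := by
  obtain ⟨n, p, lam, h⟩ := hf
  rw [funext h]
  refine continuous_finsetSum _ fun j _ => Continuous.mul ?_ ?_
  · exact (MvPolynomial.continuous_eval (p j)).comp (by fun_prop)
  · fun_prop

/-- A complex-valued Schwartz distribution on `ℝ^d` is
a continuous `ℝ`-linear map from the space `𝓓(ℝ^d, ℝ)` of real test functions to `ℂ`
(equivalently, by complexification, a continuous `ℂ`-linear form on `𝓓(ℝ^d, ℂ)`). -/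
abbrev Distr (d : ℕ) : Type := 𝓓'((⊤ : Opens (Eucl d)), ℂ)

/-- Test functions on `ℝ^d`: smooth, real-valued and compactly supported. -/
abbrev TestFn (d : ℕ) : Type := 𝓓((⊤ : Opens (Eucl d)), ℝ)

theorem hasCompactSupport_comp_add {d : ℕ} (y : Eucl d) (φ : Eucl d → ℝ) (hφ : HasCompactSupport φ) :
    HasCompactSupport (fun x => φ (x + y)) :=
  hφ.comp_homeomorph (Homeomorph.addRight y)

/-- The translate `(τ_y φ)(x) = φ(x + y)` of a test function. -/
noncomputable def translateFun {d : ℕ} (y : Eucl d) (φ : TestFn d) : TestFn d where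
  toFun x := φ (x + y)
  contDiff' := φ.contDiff.comp (contDiff_id.add contDiff_const)
  hasCompactSupport' := hasCompactSupport_comp_add y φ φ.hasCompactSupport
  tsupport_subset' := fun _ _ => trivial

/-- The translate of a compact set `K` by `-y`. -/
def translateCompact {d : ℕ} (y : Eucl d) (K : Compacts (Eucl d)) : Compacts (Eucl d) :=
  K.map (fun x => x - y) (by fun_prop)

theorem notMem_of_notMem_translateCompact {d : ℕ} {y x : Eucl d} {K : Compacts (Eucl d)}
    (hx : x ∈ ((translateCompact y K : Compacts (Eucl d)) : Set (Eucl d))ᶜ) :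
    x + y ∈ (K : Set (Eucl d))ᶜ := by
  intro h
  exact hx ⟨x + y, h, by simp⟩

/-- Translation on the test functions supported in `K`. -/
noncomputable def translateOn {d : ℕ} (y : Eucl d) (K : Compacts (Eucl d)) :
    𝓓_{K}(Eucl d, ℝ) →L[ℝ] 𝓓_{translateCompact y K}(Eucl d, ℝ) :=
  ContDiffMapSupportedIn.mkCLM ℝ (fun φ x => φ (x + y))
    (fun _ _ _ => rfl) (fun _ _ _ => rfl)
    (fun φ => φ.contDiff.comp (contDiff_id.add contDiff_const))
    (fun φ _ hx => φ.zero_on_compl (notMem_of_notMem_translateCompact hx))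
    (fun i _ => ⟨{i}, 1, zero_le_one, fun φ x _ => by
      rw [iteratedFDeriv_comp_add_right, Finset.sup_singleton, one_mul]
      exact ContDiffMapSupportedIn.norm_iteratedFDeriv_apply_le_seminorm_top ℝ⟩)

/-- Translation `τ_y` as a continuous linear operator on the space of test functions. -/
noncomputable def translate {d : ℕ} (y : Eucl d) : TestFn d →L[ℝ] TestFn d :=
  TestFunction.limitCLM ℝ (translateFun y)
    (fun K _ => (TestFunction.ofSupportedInCLM ℝ
      (Ω := ⊤) (K := translateCompact y K) (fun _ _ => trivial)).comp (translateOn y K))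
    (fun _ _ _ => rfl)

theorem translate_apply {d : ℕ} (y : Eucl d) (φ : TestFn d) (x : Eucl d) :
    translate y φ x = φ (x + y) := rfl

/-- The forward difference operator `Δ_h^m = ∑_{k=0}^m (-1)^{m-k} (m choose k) τ_{kh}` on test
functions. -/
noncomputable def testDiff {d : ℕ} (h : Eucl d) (m : ℕ) : TestFn d →L[ℝ] TestFn d :=
  ∑ k ∈ Finset.range (m + 1), ((-1 : ℝ) ^ (m - k) * (m.choose k : ℝ)) • translate ((k : ℝ) • h)

theorem testDiff_apply {d : ℕ} (h : Eucl d) (m : ℕ) (φ : TestFn d) (x : Eucl d) :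
    testDiff h m φ x
      = ∑ k ∈ Finset.range (m + 1), (-1 : ℝ) ^ (m - k) * (m.choose k : ℝ) * φ (x + (k : ℝ) • h) := by
  let ev : TestFn d →+ ℝ := ⟨⟨fun ψ => ψ x, rfl⟩, fun _ _ => rfl⟩
  have : testDiff h m φ = ∑ k ∈ Finset.range (m + 1),
      ((-1 : ℝ) ^ (m - k) * (m.choose k : ℝ)) • translate ((k : ℝ) • h) φ := by
    simp [testDiff]
  rw [this]
  exact map_sum ev _ _

/-- The forward difference of a function, `Δ_h^m f = ∑_{k=0}^m (-1)^{m-k} (m choose k) τ_{kh} f`. -/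
noncomputable def funDiff {d : ℕ} (h : Eucl d) (m : ℕ) (f : Eucl d → ℂ) : Eucl d → ℂ :=
  fun x => ∑ k ∈ Finset.range (m + 1), (-1 : ℂ) ^ (m - k) * (m.choose k : ℂ) * f (x + (k : ℝ) • h)

/-- The closed formula is the `m`-fold iterate of `(Δ_h f)(x) = f (x + h) - f x`. -/
theorem funDiff_eq_iterate {d : ℕ} (h : Eucl d) (m : ℕ) (f : Eucl d → ℂ) :
    funDiff h m f = (fwdDiff h)^[m] f := by
  ext x
  rw [fwdDiff_iter_eq_sum_shift]
  refine Finset.sum_congr rfl fun k _ => ?_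
  rw [zsmul_eq_mul, Nat.cast_smul_eq_nsmul]
  push_cast
  rfl

/-- The forward difference of a distribution, `(Δ_h^m T){φ} = T{Δ_{-h}^m φ}`. -/
noncomputable def distrDiff {d : ℕ} (h : Eucl d) (m : ℕ) (T : Distr d) : Distr d :=
  (testDiff (-h) m).precompCompactConvergenceCLM ℂ T

theorem distrDiff_apply {d : ℕ} (h : Eucl d) (m : ℕ) (T : Distr d) (φ : TestFn d) :
    distrDiff h m T φ = T (testDiff (-h) m φ) := rfl

/-- The distribution `T` is the regular distribution given by a continuous exponential polynomial
`g`, i.e. `T{φ} = ∫ φ g` for all test functions `φ`. -/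
def IsExpPolyDistr {d : ℕ} (T : Distr d) : Prop :=
  ∃ g : Eucl d → ℂ, IsExpPoly g ∧ ∀ φ : TestFn d, T φ = ∫ x : Eucl d, (φ x : ℂ) * g x

end ExpPolyDiff

/-!
Let `τ` be an action of `ℝ^d` on a topological vector space. A vector is *finite* if it lies in a
finite-dimensional invariant subspace. Suppose that `(τ_{h_k} - 1)^{m_k} u` is finite for every `k`.
The vectors `∏ (τ_{h_k} - 1)^{a_k} u` with `a_k < m_k` and a finite-dimensional invariant subspace
containing the vectors `(τ_{h_k} - 1)^{m_k} u` together span a finite-dimensional subspace stable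
under each `τ_{h_k}`. Being closed, it is stable under the closure of the group generated by the
`h_k`, which is everything, so `u` is finite.

It remains to identify the finite vectors. A continuous finite-dimensional representation of `ℝ^d`
is `x ↦ exp(∑ x_i A_i)` with commuting `A_i`, and its coefficients are exponential polynomials. For
distributions, averaging against a bump function writes a finite vector `T` as a smoothing of
another finite vector, and the symmetry of convolution shows that `T` is given by a coefficient of
the representation.
-/

namespace ExpPolyDiff

section Invariant

variable {R M : Type*} [Semiring R] [AddCommMonoid M] [Module R M]

theorem iSup_mem_invtSubmodule {ι : Sort*} {A : Module.End R M} {Z : ι → Submodule R M}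
    (h : ∀ i, Z i ∈ A.invtSubmodule) : ⨆ i, Z i ∈ A.invtSubmodule :=
  iSup_le fun i => (h i).trans (Submodule.comap_mono (le_iSup Z i))

theorem pow_mem_invtSubmodule {A : Module.End R M} {Z : Submodule R M}
    (hZ : Z ∈ A.invtSubmodule) (n : ℕ) : Z ∈ (A ^ n).invtSubmodule := by
  induction n with
  | zero => exact fun z hz => hz
  | succ n ih =>
    intro z hz
    rw [Submodule.mem_comap, pow_succ]
    exact ih (hZ hz)

theorem map_mem_invtSubmodule_of_commute {A B : Module.End R M} (hAB : Commute A B)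
    {Z : Submodule R M} (hZ : Z ∈ A.invtSubmodule) : Z.map B ∈ A.invtSubmodule := by
  rw [Module.End.mem_invtSubmodule_iff_map_le, ← Submodule.map_comp]
  change Z.map (A * B) ≤ Z.map B
  rw [hAB.eq]
  exact (Submodule.map_comp A B Z).trans_le
    (Submodule.map_mono (Module.End.mem_invtSubmodule_iff_map_le A |>.1 hZ))

theorem exists_fg_ge_mem_invtSubmodule {D : Module.End R M} {n : ℕ} {Z : Submodule R M}
    (hfg : Z.FG) (hD : Z ∈ (D ^ (n + 1)).invtSubmodule) :
    ∃ Z' : Submodule R M, Z'.FG ∧ Z ≤ Z' ∧ Z' ∈ D.invtSubmodule ∧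
      ∀ A : Module.End R M, Commute A D → Z ∈ A.invtSubmodule → Z' ∈ A.invtSubmodule := by
  let Z' : Submodule R M := ⨆ i : Fin (n + 1), Z.map (D ^ (i : ℕ))
  have pow_mem {i : ℕ} (hi : i < n + 1) {z : M} (hz : z ∈ Z) : (D ^ i) z ∈ Z' :=
    Submodule.mem_iSup_of_mem ⟨i, hi⟩ (Submodule.mem_map_of_mem hz)
  have le_Z' : Z ≤ Z' := fun z hz => pow_mem n.succ_pos hz
  have hZ'D : Z' ≤ Z'.comap D := by
    refine iSup_le fun i => ?_
    rintro _ ⟨z, hz, rfl⟩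
    rw [Submodule.mem_comap, ← Module.End.mul_apply, ← pow_succ']
    obtain hlt | heq := (Nat.lt_succ_iff.1 i.2).lt_or_eq
    · exact pow_mem (Nat.succ_lt_succ hlt) hz
    · rw [heq]
      exact le_Z' (hD hz)
  exact ⟨Z', Submodule.fg_iSup _ fun i => hfg.map _, le_Z', hZ'D,
    fun A hA hZ => iSup_mem_invtSubmodule fun i =>
      map_mem_invtSubmodule_of_commute (hA.pow_right i) hZ⟩

theorem exists_fg_ge_forall_mem_invtSubmodule {ι : Type*} [Finite ι] {D : ι → Module.End R M}
    (hcomm : ∀ j k, Commute (D j) (D k)) {n : ι → ℕ} {Z : Submodule R M} (hfg : Z.FG)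
    (hD : ∀ k, Z ∈ (D k ^ (n k + 1)).invtSubmodule) :
    ∃ Z' : Submodule R M, Z'.FG ∧ Z ≤ Z' ∧ ∀ k, Z' ∈ (D k).invtSubmodule := by
  classical
  have := Fintype.ofFinite ι
  suffices H : ∀ s : Finset ι, ∃ Z' : Submodule R M, Z'.FG ∧ Z ≤ Z' ∧
      (∀ k, Z' ∈ (D k ^ (n k + 1)).invtSubmodule) ∧ ∀ k ∈ s, Z' ∈ (D k).invtSubmodule by
    obtain ⟨Z', hfg', hle, -, hinv⟩ := H Finset.univ
    exact ⟨Z', hfg', hle, fun k => hinv k (Finset.mem_univ k)⟩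
  intro s
  induction s using Finset.induction_on with
  | empty => exact ⟨Z, hfg, le_rfl, hD, by simp⟩
  | insert a s _ ih =>
    obtain ⟨Y, hYfg, hZY, hYpow, hYs⟩ := ih
    obtain ⟨Z', hfg', hYZ', ha, hother⟩ := exists_fg_ge_mem_invtSubmodule hYfg (hYpow a)
    refine ⟨Z', hfg', hZY.trans hYZ', fun k => hother _ ((hcomm k a).pow_left _) (hYpow k),
      Finset.forall_mem_insert _ _ _ |>.2 ⟨ha, fun k hk => hother _ (hcomm k a) (hYs k hk)⟩⟩

end Invariant

section FiniteVectors

variable {G R M N : Type*} [AddMonoid G] [Semiring R] [AddCommMonoid M] [Module R M]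
  [AddCommMonoid N] [Module R N]

/-- The vectors lying in a finitely generated invariant submodule of the representation `τ`. When
`R` is a field these are the vectors whose orbit spans a finite-dimensional space. -/
def finiteVectors (τ : AddChar G (Module.End R M)) : Submodule R M where
  carrier := {u | ∃ Z : Submodule R M, Z.FG ∧ u ∈ Z ∧ ∀ x, Z ∈ (τ x).invtSubmodule}
  zero_mem' := ⟨⊥, Submodule.fg_bot, zero_mem _, fun x => Module.End.invtSubmodule.bot_mem _⟩
  add_mem' := by
    rintro u v ⟨Y, hY, hu, hYτ⟩ ⟨Z, hZ, hv, hZτ⟩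
    exact ⟨Y ⊔ Z, hY.sup hZ, Submodule.add_mem_sup hu hv,
      fun x => Module.End.invtSubmodule.sup_mem (hYτ x) (hZτ x)⟩
  smul_mem' := by
    rintro c u ⟨Z, hZ, hu, hZτ⟩
    exact ⟨Z, hZ, Z.smul_mem c hu, hZτ⟩

theorem mem_finiteVectors {τ : AddChar G (Module.End R M)} {u : M} :
    u ∈ finiteVectors τ ↔
      ∃ Z : Submodule R M, Z.FG ∧ u ∈ Z ∧ ∀ x, Z ∈ (τ x).invtSubmodule :=
  Iff.rfl

theorem map_mem_finiteVectors {τ : AddChar G (Module.End R M)} {σ : AddChar G (Module.End R N)}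
    {Λ : M →ₗ[R] N} (hΛ : ∀ x u, Λ (τ x u) = σ x (Λ u)) {u : M} (hu : u ∈ finiteVectors τ) :
    Λ u ∈ finiteVectors σ := by
  obtain ⟨Z, hZ, huZ, hZτ⟩ := mem_finiteVectors.1 hu
  refine mem_finiteVectors.2 ⟨Z.map Λ, hZ.map Λ, Submodule.mem_map_of_mem huZ, fun x => ?_⟩
  rintro _ ⟨z, hz, rfl⟩
  exact ⟨τ x z, hZτ x hz, hΛ x z⟩

/-- The vectors with continuous orbit under the representation `τ`. -/
def continuousVectors [TopologicalSpace G] [TopologicalSpace M] [ContinuousAdd M]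
    [ContinuousConstSMul R M] (τ : AddChar G (Module.End R M)) : Submodule R M where
  carrier := {u | Continuous fun x => τ x u}
  zero_mem' := by simpa using continuous_const
  add_mem' {u v} hu hv := by
    simpa only [Set.mem_ofPred_eq, map_add] using Continuous.fun_add hu hv
  smul_mem' c u hu := by
    simpa only [Set.mem_ofPred_eq, map_smul] using Continuous.fun_const_smul hu c

theorem mem_continuousVectors [TopologicalSpace G] [TopologicalSpace M] [ContinuousAdd M]
    [ContinuousConstSMul R M] {τ : AddChar G (Module.End R M)} {u : M} :
    u ∈ continuousVectors τ ↔ Continuous fun x => τ x u :=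
  Iff.rfl

theorem continuousVectors_mem_invtSubmodule [TopologicalSpace G] [ContinuousAdd G]
    [TopologicalSpace M] [ContinuousAdd M] [ContinuousConstSMul R M]
    (τ : AddChar G (Module.End R M)) (x : G) :
    continuousVectors τ ∈ (τ x).invtSubmodule := by
  intro u hu
  have : (fun y => τ y (τ x u)) = fun y => τ (y + x) u := by
    simp only [AddChar.map_add_eq_mul, Module.End.mul_apply]
  rw [Submodule.mem_comap, mem_continuousVectors, this]
  exact (mem_continuousVectors.1 hu).comp (continuous_id.add continuous_const)

end FiniteVectors

theorem sub_one_pow_apply_eq_sum {G R M : Type*} [AddCommMonoid G] [Ring R] [AddCommGroup M]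
    [Module R M] (τ : AddChar G (Module.End R M)) (h : G) (m : ℕ) (u : M) :
    ((τ h - 1) ^ m) u = ∑ k ∈ Finset.range (m + 1),
      ((-1 : ℤ) ^ (m - k) * m.choose k) • τ (k • h) u := by
  have iterate_orbit : ∀ n x, (fwdDiff h)^[n] (fun x => τ x u) x = τ x (((τ h - 1) ^ n) u) := by
    intro n
    induction n with
    | zero => simp
    | succ n ih =>
      intro x
      rw [Function.iterate_succ_apply', fwdDiff, ih, ih, AddChar.map_add_eq_mul, pow_succ']
      simp
  calc ((τ h - 1) ^ m) u = (fwdDiff h)^[m] (fun x => τ x u) 0 := by simp [iterate_orbit]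
    _ = _ := by simp only [fwdDiff_iter_eq_sum_shift, zero_add]

section Dense

variable {G : Type*}

theorem mem_invtSubmodule_neg {𝕜 M : Type*} [AddGroup G] [DivisionRing 𝕜] [AddCommGroup M]
    [Module 𝕜 M] {τ : AddChar G (Module.End 𝕜 M)} {Z : Submodule 𝕜 M} [FiniteDimensional 𝕜 Z]
    {x : G} (hZ : Z ∈ (τ x).invtSubmodule) : Z ∈ (τ (-x)).invtSubmodule := by
  have neg_apply (z : M) : τ (-x) (τ x z) = z := by
    rw [← Module.End.mul_apply, ← AddChar.map_add_eq_mul, neg_add_cancel,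
      AddChar.map_zero_eq_one, Module.End.one_apply]
  have map_eq : Z.map (τ x) = Z :=
    Submodule.eq_of_le_of_finrank_eq (Module.End.mem_invtSubmodule_iff_map_le _ |>.1 hZ)
      (Submodule.equivMapOfInjective _ (Function.LeftInverse.injective neg_apply) Z).finrank_eq.symm
  intro z hz
  obtain ⟨y, hy, rfl⟩ := map_eq.symm.le hz
  rwa [Submodule.mem_comap, neg_apply]

variable {𝕜 M ι : Type*} [NontriviallyNormedField 𝕜] [CompleteSpace 𝕜] [TopologicalSpace G]
  [AddCommGroup M] [Module 𝕜 M] [TopologicalSpace M] [IsTopologicalAddGroup M]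
  [ContinuousSMul 𝕜 M] [T2Space M] {h : ι → G}

theorem mem_invtSubmodule_of_dense [AddGroup G] {τ : AddChar G (Module.End 𝕜 M)}
    (hdense : Dense (AddSubgroup.closure (Set.range h) : Set G)) {Z : Submodule 𝕜 M}
    [FiniteDimensional 𝕜 Z] (hcont : Z ≤ continuousVectors τ)
    (hZ : ∀ k, Z ∈ (τ (h k)).invtSubmodule) (x : G) : Z ∈ (τ x).invtSubmodule := by
  have isClosed_stabilizer : IsClosed {x | Z ∈ (τ x).invtSubmodule} := by
    have : {x | Z ∈ (τ x).invtSubmodule} = ⋂ z ∈ Z, (fun x => τ x z) ⁻¹' (Z : Set M) := by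
      ext x
      simp [Module.End.mem_invtSubmodule_iff_forall_mem_of_mem]
    rw [this]
    exact isClosed_biInter fun z hz => Z.closed_of_finiteDimensional.preimage (hcont hz)
  refine isClosed_stabilizer.closure_subset_iff.2 (fun y hy => ?_) (hdense x)
  induction hy using AddSubgroup.closure_induction with
  | mem _ hy =>
    obtain ⟨k, rfl⟩ := hy
    exact hZ k
  | zero =>
    intro z hz
    rwa [Submodule.mem_comap, AddChar.map_zero_eq_one]
  | add x y _ _ hx hy =>
    intro z hz
    rw [Submodule.mem_comap, AddChar.map_add_eq_mul]
    exact hx (hy hz)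
  | neg y _ hy => exact mem_invtSubmodule_neg hy

theorem mem_finiteVectors_of_sub_one_pow_mem [AddCommGroup G] [ContinuousAdd G] [Finite ι]
    {τ : AddChar G (Module.End 𝕜 M)}
    (hdense : Dense (AddSubgroup.closure (Set.range h) : Set G)) {m : ι → ℕ} {u : M}
    (hu : u ∈ continuousVectors τ) (hm : ∀ k, ((τ (h k) - 1) ^ m k) u ∈ finiteVectors τ) :
    u ∈ finiteVectors τ := by
  choose W hWfg hWu hWτ using hm
  have commute_sub_one (x y : G) : Commute (τ x - 1) (τ y - 1) := by
    have : Commute (τ x) (τ y) := by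
      rw [commute_iff_eq, ← AddChar.map_add_eq_mul, add_comm, AddChar.map_add_eq_mul]
    exact (this.sub_left (Commute.one_left _)).sub_right (Commute.one_right _)
  have sub_one_mem {Z : Submodule 𝕜 M} {x : G} :
      Z ∈ (τ x - 1).invtSubmodule ↔ Z ∈ (τ x).invtSubmodule :=
    forall₂_congr fun z hz => Submodule.sub_mem_iff_left Z hz
  let Z₀ : Submodule 𝕜 M := (⨆ k, W k) ⊔ Submodule.span 𝕜 {u}
  have hZ₀fg : Z₀.FG := (Submodule.fg_iSup W hWfg).sup (Submodule.fg_span_singleton u)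
  have hZ₀ (k) : Z₀ ∈ ((τ (h k) - 1) ^ (m k + 1)).invtSubmodule := by
    have hWk : ⨆ j, W j ∈ (τ (h k) - 1).invtSubmodule :=
      sub_one_mem.2 (iSup_mem_invtSubmodule fun j => hWτ j _)
    refine Module.End.mem_invtSubmodule _ |>.2 (sup_le
      (le_trans (pow_mem_invtSubmodule hWk _) (Submodule.comap_mono le_sup_left)) ?_)
    rw [Submodule.span_singleton_le_iff_mem, Submodule.mem_comap, pow_succ']
    exact Submodule.mem_sup_left (hWk (Submodule.mem_iSup_of_mem k (hWu k)))
  obtain ⟨Z, hZfg, hZ₀Z, hZ⟩ :=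
    exists_fg_ge_forall_mem_invtSubmodule (fun j k => commute_sub_one (h j) (h k)) hZ₀fg hZ₀
  have := Module.Finite.iff_fg.2 hZfg
  have := Submodule.finiteDimensional_inf_left Z (continuousVectors τ)
  refine ⟨Z ⊓ continuousVectors τ, Module.Finite.iff_fg.1 this,
    ⟨hZ₀Z (Submodule.mem_sup_right (Submodule.mem_span_singleton_self u)), hu⟩,
    mem_invtSubmodule_of_dense hdense inf_le_right fun k =>
      Module.End.invtSubmodule.inf_mem (sub_one_mem.1 (hZ k))
        (continuousVectors_mem_invtSubmodule τ (h k))⟩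

end Dense

section ExpPoly

variable {d : ℕ}

theorem isExpPoly_sum {κ : Type*} [Fintype κ] (p : κ → MvPolynomial (Fin d) ℂ)
    (lam : κ → Fin d → ℂ) :
    IsExpPoly fun x : Eucl d => ∑ j, MvPolynomial.eval (fun i => (x i : ℂ)) (p j) *
      Complex.exp (∑ i : Fin d, lam j i * (x i : ℂ)) :=
  ⟨Fintype.card κ, p ∘ (Fintype.equivFin κ).symm, lam ∘ (Fintype.equivFin κ).symm, fun _ =>
    ((Fintype.equivFin κ).symm.sum_comp _).symm⟩

/-- The exponential polynomials on `ℝ^d` as an algebra under the pointwise operations. -/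
def expPolySubalgebra (d : ℕ) : Subalgebra ℂ (Eucl d → ℂ) where
  carrier := {f | IsExpPoly f}
  add_mem' := by
    rintro f g ⟨n, p, a, hf⟩ ⟨m, q, b, hg⟩
    suffices IsExpPoly fun x => f x + g x from this
    simpa [hf, hg] using isExpPoly_sum (Sum.elim p q) (Sum.elim a b)
  mul_mem' := by
    rintro f g ⟨n, p, a, hf⟩ ⟨m, q, b, hg⟩
    suffices IsExpPoly fun x => f x * g x from this
    simpa only [hf, hg, Finset.sum_mul_sum, Fintype.sum_prod_type, Pi.add_apply, add_mul,
      Finset.sum_add_distrib, Complex.exp_add, map_mul, mul_mul_mul_comm] using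
      isExpPoly_sum (fun j : Fin n × Fin m => p j.1 * q j.2) fun j => a j.1 + b j.2
  algebraMap_mem' c := by
    have : algebraMap ℂ (Eucl d → ℂ) c = fun _ => c := rfl
    simpa [this] using isExpPoly_sum (fun _ : Unit => MvPolynomial.C c) 0

theorem mem_expPolySubalgebra {f : Eucl d → ℂ} : f ∈ expPolySubalgebra d ↔ IsExpPoly f :=
  Iff.rfl

theorem isExpPoly_coord (i : Fin d) : IsExpPoly fun x : Eucl d => (x i : ℂ) := by
  simpa using isExpPoly_sum (fun _ : Unit => MvPolynomial.X i) 0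

theorem isExpPoly_exp_coord_mul (i : Fin d) (c : ℂ) :
    IsExpPoly fun x : Eucl d => Complex.exp (x i * c) := by
  simpa [Pi.single_apply, mul_comm] using isExpPoly_sum 1 (fun _ : Unit => Pi.single i c)

end ExpPoly

section OneParameterGroup

variable {B : Type*} [NormedRing B] [NormedAlgebra ℝ B] [CompleteSpace B]

theorem exists_isUnit_intervalIntegral {f : ℝ → B} (hf : Continuous f) (h0 : f 0 = 1) :
    ∃ t, IsUnit (∫ u in (0 : ℝ)..t, f u) := by
  have hderiv : HasDerivAt (fun t => ∫ u in (0 : ℝ)..t, f u) 1 0 :=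
    h0 ▸ (hf.integral_hasStrictDerivAt 0 0).hasDerivAt
  have hslope := hderiv.tendsto_slope_zero
  simp only [zero_add, intervalIntegral.integral_same, sub_zero] at hslope
  obtain ⟨t, hunit, ht : t ≠ 0⟩ := ((hslope.eventually
    (Units.isOpen.mem_nhds (isUnit_one (M := B)))).and self_mem_nhdsWithin).exists
  refine ⟨t, ?_⟩
  simpa [Units.smul_def, smul_smul, ht] using hunit.smul (Units.mk0 t ht)

theorem exists_hasDerivAt_mul {r : AddChar ℝ B} (hr : Continuous r) :
    ∃ A : B, ∀ s, HasDerivAt r (r s * A) s := by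
  let I : ℝ → B := fun t => ∫ u in (0 : ℝ)..t, r u
  have hI (t : ℝ) : HasDerivAt I (r t) t := (hr.integral_hasStrictDerivAt 0 t).hasDerivAt
  obtain ⟨t, v, hv : v = I t⟩ := exists_isUnit_intervalIntegral hr r.map_zero_eq_one
  have mul_I (s : ℝ) : r s * I t = I (s + t) - I s := by
    calc r s * I t = ∫ u in (0 : ℝ)..t, r (s + u) := by
          simp only [I, AddChar.map_add_eq_mul]
          exact ((ContinuousLinearMap.mul ℝ B (r s)).intervalIntegral_comp_comm
            (hr.intervalIntegrable 0 t)).symm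
      _ = ∫ u in s..s + t, r u := by rw [intervalIntegral.integral_comp_add_left, add_zero]
      _ = I (s + t) - I s := (intervalIntegral.integral_interval_sub_left
          (hr.intervalIntegrable _ _) (hr.intervalIntegrable _ _)).symm
  have r_eq : r = fun s => (I (s + t) - I s) * ↑v⁻¹ := by
    ext s
    rw [← mul_I, ← hv, Units.mul_inv_cancel_right]
  refine ⟨(r t - 1) * ↑v⁻¹, fun s => ?_⟩
  have hd : HasDerivAt (fun s => (I (s + t) - I s) * ↑v⁻¹) ((r (s + t) - r s) * ↑v⁻¹) s :=
    (((hI (s + t)).comp_add_const s t).sub (hI s)).mul_const _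
  rw [← r_eq] at hd
  convert hd using 1
  rw [AddChar.map_add_eq_mul, ← mul_assoc, mul_sub, mul_one]

theorem exists_eq_exp_smul {r : AddChar ℝ B} (hr : Continuous r) :
    ∃ A : B, ∀ t, r t = NormedSpace.exp (t • A) := by
  obtain ⟨A, hA⟩ := exists_hasDerivAt_mul hr
  have exp_mul_exp (t : ℝ) : NormedSpace.exp (t • -A) * NormedSpace.exp (t • A) = 1 := by
    let : NormedAlgebra ℚ B := NormedAlgebra.restrictScalars ℚ ℝ B
    rw [smul_neg, ← NormedSpace.exp_add_of_commute (Commute.refl (t • A)).neg_left,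
      neg_add_cancel, NormedSpace.exp_zero]
  have hderiv (t : ℝ) : HasDerivAt (fun t => r t * NormedSpace.exp (t • -A)) 0 t := by
    refine ((hA t).mul (hasDerivAt_exp_smul_const' (-A) t)).congr_deriv ?_
    simp [mul_assoc]
  refine ⟨A, fun t => ?_⟩
  have hconst : r t * NormedSpace.exp (t • -A) = 1 := by
    simpa using is_const_of_deriv_eq_zero (fun t => (hderiv t).differentiableAt)
      (fun t => (hderiv t).deriv) t 0
  calc r t = r t * NormedSpace.exp (t • -A) * NormedSpace.exp (t • A) := by
        rw [mul_assoc, exp_mul_exp, mul_one]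
    _ = NormedSpace.exp (t • A) := by rw [hconst, one_mul]

end OneParameterGroup

section Coefficients

variable {F : Type*} [NormedAddCommGroup F] [NormedSpace ℂ F]

theorem exp_apply_of_pow_apply_eq_zero [CompleteSpace F] {D : F →L[ℂ] F} {v : F} {N : ℕ}
    (hD : (D ^ N) v = 0) :
    NormedSpace.exp D v = ∑ k ∈ Finset.range N, (k.factorial : ℂ)⁻¹ • (D ^ k) v := by
  have hsum : HasSum (fun k : ℕ => (k.factorial : ℂ)⁻¹ • (D ^ k) v) (NormedSpace.exp D v) :=
    (NormedSpace.exp_series_hasSum_exp' (𝕂 := ℂ) D).mapL (ContinuousLinearMap.apply ℂ F v)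
  refine hsum.unique (hasSum_sum_of_ne_finset_zero fun k hk => ?_)
  obtain ⟨j, rfl⟩ := Nat.exists_eq_add_of_le (not_lt.1 (mt Finset.mem_range.2 hk))
  rw [add_comm, pow_add, mul_apply_eq_comp, hD, map_zero, smul_zero]

theorem exp_apply_of_sub_algebraMap_pow_apply_eq_zero [CompleteSpace F] {A : F →L[ℂ] F} {c : ℂ}
    {v : F} {N : ℕ} (hA : ((A - algebraMap ℂ (F →L[ℂ] F) c) ^ N) v = 0) (z : ℂ) :
    NormedSpace.exp (z • A) v = Complex.exp (z * c) • ∑ k ∈ Finset.range N,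
      (z ^ k / k.factorial) • ((A - algebraMap ℂ (F →L[ℂ] F) c) ^ k) v := by
  set D := A - algebraMap ℂ (F →L[ℂ] F) c with hD
  have split : z • A = algebraMap ℂ _ (z * c) + z • D := by
    rw [hD, smul_sub, map_mul, ← Algebra.smul_def, add_sub_cancel]
  have hzD : ((z • D) ^ N) v = 0 := by
    rw [smul_pow, smul_apply, hA, smul_zero]
  let : NormedAlgebra ℚ (F →L[ℂ] F) := NormedAlgebra.restrictScalars ℚ ℂ _
  rw [split, NormedSpace.exp_add_of_commute (Algebra.commutes _ _),
    ← NormedSpace.algebraMap_exp_comm, mul_apply_eq_comp, exp_apply_of_pow_apply_eq_zero hzD,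
    ← Complex.exp_eq_exp_ℂ, Algebra.algebraMap_eq_smul_one, smul_apply,
    one_apply_eq_self]
  simp only [smul_pow, smul_apply, smul_smul, div_eq_inv_mul]

variable {d : ℕ} [FiniteDimensional ℂ F]

theorem isExpPoly_exp_coord_smul_apply (A : F →L[ℂ] F) (l : F →ₗ[ℂ] ℂ) (v : F) (i : Fin d) :
    IsExpPoly fun x : Eucl d => l (NormedSpace.exp (x i • A) v) := by
  have : CompleteSpace F := FiniteDimensional.complete ℂ F
  have hv : v ∈ ⨆ c, Module.End.maxGenEigenspace (A : F →ₗ[ℂ] F) c :=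
    Module.End.iSup_maxGenEigenspace_eq_top (A : F →ₗ[ℂ] F) ▸ Submodule.mem_top
  induction hv using Submodule.iSup_induction' with
  | zero =>
    simp only [map_zero]
    exact (expPolySubalgebra d).zero_mem
  | add a b _ _ ha hb =>
    simp only [map_add]
    exact (expPolySubalgebra d).add_mem ha hb
  | mem c v hv =>
    obtain ⟨N, hN⟩ := (Module.End.mem_maxGenEigenspace _ _ _).1 hv
    set D := A - algebraMap ℂ (F →L[ℂ] F) c with hD
    have hDN : (D ^ N) v = 0 := by
      rw [Module.End.pow_apply] at hN
      rw [FunLike.coe_pow_eq_iterate, hD, Algebra.algebraMap_eq_smul_one]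
      exact hN
    have expand : (fun x : Eucl d => l (NormedSpace.exp (x i • A) v)) =
        (fun x => Complex.exp (x i * c)) * ∑ k ∈ Finset.range N,
          (l ((D ^ k) v) / k.factorial) • (fun x : Eucl d => (x i : ℂ)) ^ k := by
      ext x
      rw [← Complex.coe_smul, exp_apply_of_sub_algebraMap_pow_apply_eq_zero hDN, ← hD]
      simp only [map_smul, map_sum, smul_eq_mul, Pi.mul_apply, Finset.sum_apply, Pi.smul_apply,
        Pi.pow_apply, div_mul_comm]
    rw [expand]
    exact mul_mem (mem_expPolySubalgebra.2 (isExpPoly_exp_coord_mul i c)) (sum_mem fun k _ =>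
      Subalgebra.smul_mem _ (pow_mem (mem_expPolySubalgebra.2 (isExpPoly_coord i)) k) _)

theorem isExpPoly_coefficient {ρ : AddChar (Eucl d) (F →L[ℂ] F)} (hρ : Continuous ρ)
    (l : F →ₗ[ℂ] ℂ) (v : F) : IsExpPoly fun x => l (ρ x v) := by
  classical
  have : CompleteSpace F := FiniteDimensional.complete ℂ F
  let e : Fin d → Eucl d := fun i => EuclideanSpace.single i 1
  suffices H : ∀ s : Finset (Fin d), ∀ (l : F →ₗ[ℂ] ℂ) (v : F),
      IsExpPoly fun x : Eucl d => l (ρ (∑ i ∈ s, x i • e i) v) by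
    have sum_coord (x : Eucl d) : ∑ i, x i • e i = x := by
      ext j
      simp [e, Pi.single_apply]
    simpa only [sum_coord] using H Finset.univ l v
  intro s
  induction s using Finset.induction_on with
  | empty =>
    intro l v
    simp only [Finset.sum_empty, AddChar.map_zero_eq_one]
    exact (expPolySubalgebra d).algebraMap_mem (l v)
  | insert i s hi ih =>
    intro l v
    let b := Module.finBasis ℂ F
    let r : AddChar ℝ (F →L[ℂ] F) :=
      ρ.compAddMonoidHom (LinearMap.toSpanSingleton ℝ _ (e i)).toAddMonoidHom
    obtain ⟨A, hA⟩ := exists_eq_exp_smul (r := r)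
      (hρ.comp (continuous_id.smul continuous_const))
    have expand : (fun x : Eucl d => l (ρ (∑ j ∈ insert i s, x j • e j) v)) =
        ∑ j, (fun x => b.coord j (ρ (∑ j ∈ s, x j • e j) v)) *
          fun x => l (NormedSpace.exp (x i • A) (b j)) := by
      ext x
      rw [Finset.sum_insert hi, AddChar.map_add_eq_mul, mul_apply_eq_comp]
      conv_lhs => rw [← b.sum_repr (ρ (∑ j ∈ s, x j • e j) v)]
      simp only [map_sum, map_smul, smul_eq_mul, Module.Basis.coord_apply, ← hA, Finset.sum_apply]
      rfl
    rw [expand]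
    exact sum_mem (S := expPolySubalgebra d) fun j _ => mul_mem (mem_expPolySubalgebra.2 (ih _ v))
      (mem_expPolySubalgebra.2 (isExpPoly_exp_coord_smul_apply A l (b j) i))

end Coefficients

section Coordinates

variable {𝕜 G M : Type*} [NontriviallyNormedField 𝕜] [CompleteSpace 𝕜] [TopologicalSpace G]
  [AddMonoid G] [ContinuousAdd G] [AddCommGroup M] [Module 𝕜 M] [TopologicalSpace M]
  [IsTopologicalAddGroup M] [ContinuousSMul 𝕜 M] [T2Space M]

theorem exists_continuous_addChar_of_mem_finiteVectors {τ : AddChar G (Module.End 𝕜 M)} {u : M}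
    (hfin : u ∈ finiteVectors τ) (hcont : u ∈ continuousVectors τ) :
    ∃ (n : ℕ) (ρ : AddChar G ((Fin n → 𝕜) →L[𝕜] (Fin n → 𝕜))) (e : (Fin n → 𝕜) →ₗ[𝕜] M),
      Continuous ρ ∧ (∀ x v, e (ρ x v) = τ x (e v)) ∧ ∃ v, e v = u := by
  obtain ⟨Y, hYfg, huY, hY⟩ := mem_finiteVectors.1 hfin
  let Z : Submodule 𝕜 M := Y ⊓ continuousVectors τ
  have := Module.Finite.iff_fg.2 hYfg
  have : FiniteDimensional 𝕜 Z := Submodule.finiteDimensional_inf_left Y _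
  have hZ (x : G) : Z ∈ (τ x).invtSubmodule :=
    Module.End.invtSubmodule.inf_mem (hY x) (continuousVectors_mem_invtSubmodule τ x)
  let b := (Module.finBasis 𝕜 Z).equivFun
  let r (x : G) : (Fin (Module.finrank 𝕜 Z) → 𝕜) →L[𝕜] (Fin (Module.finrank 𝕜 Z) → 𝕜) :=
    (b.toLinearMap ∘ₗ (τ x).restrict (hZ x) ∘ₗ b.symm.toLinearMap).toContinuousLinearMap
  let e : (Fin (Module.finrank 𝕜 Z) → 𝕜) →ₗ[𝕜] M := Z.subtype ∘ₗ b.symm.toLinearMap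
  have he : Function.Injective e := Subtype.val_injective.comp b.symm.injective
  have e_r (x v) : e (r x v) = τ x (e v) := by
    simp only [r, e, LinearMap.coe_toContinuousLinearMap', LinearMap.comp_apply,
      LinearEquiv.coe_coe, LinearEquiv.symm_apply_apply, Submodule.subtype_apply]
    rfl
  let ρ : AddChar G ((Fin (Module.finrank 𝕜 Z) → 𝕜) →L[𝕜] (Fin (Module.finrank 𝕜 Z) → 𝕜)) :=
    { toFun := r
      map_zero_eq_one' := ContinuousLinearMap.ext fun v => he <| by
        rw [e_r, AddChar.map_zero_eq_one, Module.End.one_apply, one_apply_eq_self]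
      map_add_eq_mul' := fun x y => ContinuousLinearMap.ext fun v => he <| by
        rw [e_r, AddChar.map_add_eq_mul, Module.End.mul_apply, mul_apply_eq_comp, e_r, e_r] }
  refine ⟨_, ρ, e, continuous_clm_apply.2 fun v => ?_, e_r, b ⟨u, huY, hcont⟩, by simp [e]⟩
  have hb : Continuous b := b.toLinearMap.continuous_of_finiteDimensional
  exact hb.comp (Continuous.subtype_mk (b.symm v).2.2 fun x => hZ x (b.symm v).2)

end Coordinates

section Translation

variable {G R : Type*} [AddMonoid G] [TopologicalSpace G] [ContinuousAdd G] [CommRing R]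
  [TopologicalSpace R] [IsTopologicalRing R]

variable (G R) in
/-- The translation action `(τ_x f)(y) = f (y + x)` on continuous functions. -/
def translation : AddChar G (Module.End R C(G, R)) where
  toFun x := (ContinuousMap.compRightAlgHom R R (ContinuousMap.addRight x)).toLinearMap
  map_zero_eq_one' := by
    ext f y
    simp
  map_add_eq_mul' x z := by
    ext f y
    simp [add_assoc]

@[simp]
theorem translation_apply_apply (x : G) (f : C(G, R)) (y : G) :
    translation G R x f y = f (y + x) := rfl

theorem mem_continuousVectors_translation (f : C(G, R)) :
    f ∈ continuousVectors (translation G R) :=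
  mem_continuousVectors.2
    (ContinuousMap.curry ⟨fun p : G × G => f (p.2 + p.1), by fun_prop⟩).continuous

theorem translation_sub_one_pow_apply {G : Type*} [AddCommMonoid G] [TopologicalSpace G]
    [ContinuousAdd G] (h : G) (m : ℕ) (f : C(G, R)) :
    ⇑(((translation G R h - 1) ^ m) f) = (fwdDiff h)^[m] f := by
  induction m with
  | zero => rfl
  | succ m ih =>
    ext x
    rw [pow_succ', Function.iterate_succ_apply', ← ih]
    rfl

theorem mem_finiteVectors_translation_of_map_mul {f : C(G, R)} (hf : ∀ x y, f (x + y) = f x * f y) :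
    f ∈ finiteVectors (translation G R) := by
  refine mem_finiteVectors.2 ⟨R ∙ f, Submodule.fg_span_singleton f,
    Submodule.mem_span_singleton_self f, fun x => ?_⟩
  rw [Module.End.mem_invtSubmodule, Submodule.span_singleton_le_iff_mem, Submodule.mem_comap,
    Submodule.mem_span_singleton]
  refine ⟨f x, ?_⟩
  ext y
  simp [hf, mul_comm]

theorem mem_finiteVectors_translation_of_map_add {f : C(G, R)} (hf : ∀ x y, f (x + y) = f x + f y) :
    f ∈ finiteVectors (translation G R) := by
  refine mem_finiteVectors.2 ⟨Submodule.span R {1, f}, Submodule.fg_span (Set.toFinite _),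
    Submodule.subset_span (by simp), fun x => ?_⟩
  have one_eq : translation G R x 1 = 1 := rfl
  have f_eq : translation G R x f = f + f x • 1 := by
    ext y
    simp [hf]
  rw [Module.End.mem_invtSubmodule, Submodule.span_le, Set.pair_subset_iff]
  simp only [SetLike.mem_coe, Submodule.mem_comap, one_eq, f_eq]
  have one_mem : (1 : C(G, R)) ∈ Submodule.span R {1, f} := Submodule.subset_span (by simp)
  exact ⟨one_mem, add_mem (Submodule.subset_span (by simp)) (Submodule.smul_mem _ _ one_mem)⟩

variable (G R) in
/-- The algebra of continuous functions whose translates span a finitely generated module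
(more precisely, are contained in a translation-invariant one). -/
def finiteFunctions : Subalgebra R C(G, R) :=
  (finiteVectors (translation G R)).toSubalgebra
    (mem_finiteVectors_translation_of_map_mul fun _ _ => (mul_one 1).symm) <| by
      rintro f g ⟨Y, hY, hf, hYτ⟩ ⟨Z, hZ, hg, hZτ⟩
      refine ⟨Y * Z, hY.mul hZ, Submodule.mul_mem_mul hf hg, fun x => ?_⟩
      rw [Module.End.mem_invtSubmodule_iff_map_le]
      exact (Submodule.map_mul Y Z _).trans_le <| mul_le_mul'
        ((Module.End.mem_invtSubmodule_iff_map_le _).1 (hYτ x))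
        ((Module.End.mem_invtSubmodule_iff_map_le _).1 (hZτ x))

end Translation

section ExpPolyTranslation

variable {d : ℕ}

theorem IsExpPoly.mem_finiteVectors_translation {f : C(Eucl d, ℂ)} (hf : IsExpPoly f) :
    f ∈ finiteVectors (translation (Eucl d) ℂ) := by
  obtain ⟨n, p, lam, hf⟩ := hf
  let coord (i : Fin d) : finiteFunctions (Eucl d) ℂ :=
    ⟨⟨fun x => (x i : ℂ), by fun_prop⟩, mem_finiteVectors_translation_of_map_add fun x y => by simp⟩
  let exponential (a : Fin d → ℂ) : finiteFunctions (Eucl d) ℂ :=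
    ⟨⟨fun x => Complex.exp (∑ i, a i * (x i : ℂ)), by fun_prop⟩,
      mem_finiteVectors_translation_of_map_mul fun x y => by
        simp [mul_add, Finset.sum_add_distrib, Complex.exp_add]⟩
  have expand : f = ∑ j, MvPolynomial.aeval coord (p j) * exponential (lam j) := by
    ext x
    let evalAt : finiteFunctions (Eucl d) ℂ →ₐ[ℂ] ℂ :=
      (ContinuousMap.evalAlgHom ℂ ℂ x).comp (finiteFunctions (Eucl d) ℂ).val
    have evalAt_aeval (q : MvPolynomial (Fin d) ℂ) :
        evalAt (MvPolynomial.aeval coord q) = MvPolynomial.eval (fun i => (x i : ℂ)) q := by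
      rw [MvPolynomial.comp_aeval_apply, ← MvPolynomial.coe_aeval_eq_eval]
      rfl
    calc f x = ∑ j, evalAt (MvPolynomial.aeval coord (p j)) * evalAt (exponential (lam j)) := by
          simp only [hf, evalAt_aeval]
          rfl
      _ = evalAt (∑ j, MvPolynomial.aeval coord (p j) * exponential (lam j)) := by
          simp only [map_sum, map_mul]
  rw [expand]
  exact SetLike.coe_mem _

theorem mem_finiteVectors_translation_iff {f : C(Eucl d, ℂ)} :
    f ∈ finiteVectors (translation (Eucl d) ℂ) ↔ IsExpPoly f := by
  refine ⟨fun hf => ?_, IsExpPoly.mem_finiteVectors_translation⟩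
  obtain ⟨n, ρ, e, hρ, he, v, rfl⟩ :=
    exists_continuous_addChar_of_mem_finiteVectors hf (mem_continuousVectors_translation f)
  have eval_zero (x : Eucl d) : e v x = e (ρ x v) 0 := by
    rw [he, translation_apply_apply, zero_add]
  rw [funext eval_zero]
  exact isExpPoly_coefficient hρ ((ContinuousMap.evalAlgHom ℂ ℂ (0 : Eucl d)).toLinearMap ∘ₗ e) v

end ExpPolyTranslation

theorem continuous_compContinuous_addRight {G β : Type*} [SeminormedAddCommGroup G]
    [PseudoMetricSpace β] {f : BoundedContinuousFunction G β} (hf : UniformContinuous f) :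
    Continuous fun x => f.compContinuous (ContinuousMap.addRight x) := by
  refine Metric.continuous_iff.2 fun x ε hε => ?_
  obtain ⟨δ, hδ, hfδ⟩ := Metric.uniformContinuous_iff.1 hf (ε / 2) (half_pos hε)
  refine ⟨δ, hδ, fun a ha => lt_of_le_of_lt ?_ (half_lt_self hε)⟩
  exact (BoundedContinuousFunction.dist_le (half_pos hε).le).2 fun y =>
    (hfδ (by simpa using ha)).le

theorem exists_continuousLinearMap_apply_eq {𝕜 M X F : Type*} [NontriviallyNormedField 𝕜]
    [IsRCLikeNormedField 𝕜] [AddCommGroup M] [Module 𝕜 M] [NormedAddCommGroup X] [NormedSpace 𝕜 X]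
    [NormedAddCommGroup F] [NormedSpace 𝕜 F] [FiniteDimensional 𝕜 F] [CompleteSpace F]
    (J : M →ₗ[𝕜] X) (T : M →ₗ[𝕜] F) {C : ℝ} (hT : ∀ v, ‖T v‖ ≤ C * ‖J v‖) :
    ∃ L : X →L[𝕜] F, ∀ v, L (J v) = T v := by
  obtain ⟨L, hL⟩ :=
    (T.extendOfNorm J.rangeRestrict).exist_extension_of_finiteDimensional_range
  refine ⟨L, fun v => ?_⟩
  rw [← LinearMap.extendOfNorm_eq J.surjective_rangeRestrict.denseRange ⟨C, hT⟩, hL]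
  rfl

section Convolution

open scoped Convolution Pointwise

theorem iteratedFDeriv_convolution_right {E F : Type*} [NormedAddCommGroup E] [NormedSpace ℝ E]
    [MeasurableSpace E] [BorelSpace E] [NormedAddCommGroup F] [NormedSpace ℝ F]
    (μ : Measure E) [SFinite μ] [μ.IsAddLeftInvariant]
    {f : E → ℝ} {g : E → F} (hf : LocallyIntegrable f μ)
    (hg : ContDiff ℝ (⊤ : ℕ∞) g) (hgc : HasCompactSupport g) (i : ℕ) :
    iteratedFDeriv ℝ i (f ⋆[ContinuousLinearMap.lsmul ℝ ℝ, μ] g) =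
      f ⋆[ContinuousLinearMap.lsmul ℝ ℝ, μ] iteratedFDeriv ℝ i g := by
  induction i with
  | zero =>
    ext1 y
    simp only [iteratedFDeriv_zero_eq_comp, convolution_def, Function.comp_apply]
    rw [← LinearIsometryEquiv.coe_toContinuousLinearEquiv,
      ← ContinuousLinearEquiv.integral_comp_comm]
    simp
  | succ i ih =>
    ext1 y
    have hgi : ContDiff ℝ 1 (iteratedFDeriv ℝ i g) :=
      hg.iteratedFDeriv_right (by exact_mod_cast le_top)
    rw [iteratedFDeriv_succ_eq_comp_left, Function.comp_apply, ih,
      ((hgc.iteratedFDeriv i).hasFDerivAt_convolution_right _ hf hgi y).fderiv]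
    simp only [convolution_def]
    refine (ContinuousLinearEquiv.integral_comp_comm (𝕜 := ℝ) (μ := μ)
      (E := E →L[ℝ] E [×i]→L[ℝ] F) (F := E [×(i + 1)]→L[ℝ] F)
      (continuousMultilinearCurryLeftEquiv ℝ
        (fun _ : Fin (i + 1) => E) F).symm.toContinuousLinearEquiv
      fun t => f t • fderiv ℝ (iteratedFDeriv ℝ i g) (y - t)).symm.trans ?_
    refine integral_congr_ae (Filter.Eventually.of_forall fun t => ?_)
    simp only [iteratedFDeriv_succ_eq_comp_left, Function.comp_apply,
      ContinuousLinearMap.lsmul_apply, map_smul]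
    rfl

variable {d : ℕ}

/-- The convolution of two test functions, as a test function. -/
noncomputable def testConvolution (φ ψ : TestFn d) : TestFn d where
  toFun := φ ⋆[ContinuousLinearMap.lsmul ℝ ℝ, volume] ψ
  contDiff' := ψ.hasCompactSupport.contDiff_convolution_right _
    φ.continuous.locallyIntegrable ψ.contDiff
  hasCompactSupport' := φ.hasCompactSupport.convolution _ ψ.hasCompactSupport
  tsupport_subset' := Set.subset_univ _

theorem coe_testConvolution (φ ψ : TestFn d) :
    ⇑(testConvolution φ ψ) = φ ⋆[ContinuousLinearMap.lsmul ℝ ℝ, volume] ψ := rfl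

theorem testConvolution_comm (φ ψ : TestFn d) : testConvolution φ ψ = testConvolution ψ φ := by
  have lsmul_flip : (ContinuousLinearMap.lsmul ℝ ℝ : ℝ →L[ℝ] ℝ →L[ℝ] ℝ).flip =
      ContinuousLinearMap.lsmul ℝ ℝ := by
    ext
    simp
  refine DFunLike.coe_injective ?_
  rw [coe_testConvolution, coe_testConvolution, ← convolution_flip, lsmul_flip]

theorem support_testConvolution_subset (φ ψ : TestFn d) :
    Function.support (testConvolution φ ψ) ⊆ Function.support φ + Function.support ψ :=
  support_convolution_subset _

theorem iteratedFDeriv_testConvolution (φ ψ : TestFn d) (i : ℕ) (y : Eucl d) :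
    iteratedFDeriv ℝ i (testConvolution φ ψ) y =
      ∫ x, φ x • iteratedFDeriv ℝ i ψ (y - x) := by
  rw [coe_testConvolution, iteratedFDeriv_convolution_right _ φ.continuous.locallyIntegrable
    ψ.contDiff ψ.hasCompactSupport, convolution_def]
  rfl

end Convolution

section Jet

variable {d : ℕ}

open scoped Pointwise

theorem iteratedFDeriv_translate (i : ℕ) (x y : Eucl d) (φ : TestFn d) :
    iteratedFDeriv ℝ i (translate x φ) y = iteratedFDeriv ℝ i φ (y + x) :=
  iteratedFDeriv_comp_add_right ..

theorem support_translate_neg_subset (φ : TestFn d) (x : Eucl d) :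
    Function.support (translate (-x) φ) ⊆ {x} + Function.support φ :=
  fun y hy => ⟨x, rfl, y + -x, hy, by simp⟩

/-- The bounded continuous fields of `i`-linear forms, among which are the `i`-th derivatives of the
test functions. -/
abbrev BoundedForms (d i : ℕ) : Type :=
  BoundedContinuousFunction (Eucl d) (Eucl d [×i]→L[ℝ] ℝ)

/-- The Banach space to which the tuple of the derivatives of orders in `s` of a test function
belongs. On the test functions supported in a fixed compact set a distribution factors through such
a space, in which vector-valued integrals are available. -/
def JetSpace (d : ℕ) (s : Finset ℕ) : Type := Π i : s, BoundedForms d i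

noncomputable instance (s : Finset ℕ) : NormedAddCommGroup (JetSpace d s) :=
  inferInstanceAs (NormedAddCommGroup (Π i : s, BoundedForms d i))

noncomputable instance (s : Finset ℕ) : NormedSpace ℝ (JetSpace d s) :=
  inferInstanceAs (NormedSpace ℝ (Π i : s, BoundedForms d i))

instance (s : Finset ℕ) : CompleteSpace (JetSpace d s) :=
  inferInstanceAs (CompleteSpace (Π i : s, BoundedForms d i))

/-- The value at `y` of the component of order `i`. -/
noncomputable def JetSpace.evalAt {s : Finset ℕ} (i : s) (y : Eucl d) :
    JetSpace d s →L[ℝ] Eucl d [×(i : ℕ)]→L[ℝ] ℝ :=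
  (BoundedContinuousFunction.evalCLM ℝ y).comp
    (ContinuousLinearMap.proj (R := ℝ) (φ := fun i : s => BoundedForms d i) i)

theorem continuous_iteratedFDeriv_testFn (φ : TestFn d) (i : ℕ) :
    Continuous (iteratedFDeriv ℝ i φ) :=
  φ.contDiff.continuous_iteratedFDeriv (by exact_mod_cast le_top)

/-- The `i`-th derivative of a test function, as a bounded continuous function. -/
noncomputable def jet (i : ℕ) (φ : TestFn d) : BoundedForms d i :=
  .ofNormedAddCommGroup (iteratedFDeriv ℝ i φ) (continuous_iteratedFDeriv_testFn φ i) _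
    (Classical.choose_spec <|
      (continuous_iteratedFDeriv_testFn φ i).bounded_above_of_compact_support
        (φ.hasCompactSupport.iteratedFDeriv i))

/-- The derivatives of a test function with orders in `s`. -/
noncomputable def jets (s : Finset ℕ) (φ : TestFn d) : JetSpace d s := fun i => jet i φ

theorem continuous_jets_translate (s : Finset ℕ) (φ : TestFn d) :
    Continuous fun x => jets s (translate x φ) := by
  refine continuous_pi fun i : s => ?_
  have hφ : UniformContinuous (jet i φ) :=
    (φ.hasCompactSupport.iteratedFDeriv i).uniformContinuous_of_continuous (jet i φ).continuous
  refine (continuous_compContinuous_addRight hφ).congr fun x => ?_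
  ext1 y
  exact (iteratedFDeriv_translate i x y φ).symm

theorem integrable_testFn_smul {B : Type*} [NormedAddCommGroup B] [NormedSpace ℝ B]
    {g : Eucl d → B} (hg : Continuous g) (φ : TestFn d) : Integrable fun x => φ x • g x :=
  (φ.continuous.smul hg).integrable_of_hasCompactSupport φ.hasCompactSupport.smul_right

theorem integral_smul_jets_translate (s : Finset ℕ) (φ ψ : TestFn d) :
    ∫ x, φ x • jets s (translate (-x) ψ) = jets s (testConvolution φ ψ) := by
  have hint : Integrable fun x => φ x • jets s (translate (-x) ψ) :=
    integrable_testFn_smul ((continuous_jets_translate s ψ).comp continuous_neg) φ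
  funext i
  ext1 y
  calc JetSpace.evalAt i y (∫ x, φ x • jets s (translate (-x) ψ))
      = ∫ x, JetSpace.evalAt i y (φ x • jets s (translate (-x) ψ)) :=
        ((JetSpace.evalAt i y).integral_comp_comm hint).symm
    _ = ∫ x, φ x • iteratedFDeriv ℝ i ψ (y - x) := by
        simp only [map_smul, sub_eq_add_neg, ← iteratedFDeriv_translate]
        rfl
    _ = JetSpace.evalAt i y (jets s (testConvolution φ ψ)) :=
        (iteratedFDeriv_testConvolution φ ψ i y).symm

variable {F : Type*} [NormedAddCommGroup F] [NormedSpace ℝ F] [FiniteDimensional ℝ F]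

theorem exists_eq_jets (T : TestFn d →L[ℝ] F) {K : Set (Eucl d)} (hK : IsCompact K) :
    ∃ (s : Finset ℕ) (L : JetSpace d s →L[ℝ] F),
      ∀ φ : TestFn d, Function.support φ ⊆ K → T φ = L (jets s φ) := by
  let inc : 𝓓_{⟨K, hK⟩}(Eucl d, ℝ) →L[ℝ] TestFn d :=
    TestFunction.ofSupportedInCLM ℝ (Set.subset_univ _)
  let TK := T.comp inc
  obtain ⟨s, C, -, hC⟩ := Seminorm.bound_of_continuous
    (ContDiffMapSupportedIn.withSeminorms ℝ (Eucl d) ℝ ⊤ ⟨K, hK⟩)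
    ((normSeminorm ℝ F).comp TK.toLinearMap) (continuous_norm.comp TK.continuous)
  let J : 𝓓_{⟨K, hK⟩}(Eucl d, ℝ) →ₗ[ℝ] JetSpace d s :=
    LinearMap.pi (φ := fun i : s => BoundedForms d i) fun i =>
      ContDiffMapSupportedIn.structureMapLM ℝ ⊤ i
  have hbound (φ) : ‖TK φ‖ ≤ C * ‖J φ‖ := by
    refine (hC φ).trans ?_
    rw [smul_apply, NNReal.smul_def, smul_eq_mul]
    gcongr
    exact Seminorm.finset_sup_apply_le (norm_nonneg _) fun i hi =>
      norm_le_pi_norm (G := fun i : s => BoundedForms d i) (J φ) ⟨i, hi⟩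
  have := FiniteDimensional.complete ℝ F
  obtain ⟨L, hL⟩ := exists_continuousLinearMap_apply_eq J TK.toLinearMap hbound
  refine ⟨s, L, fun φ hφ => ?_⟩
  let φK : 𝓓_{⟨K, hK⟩}(Eucl d, ℝ) := ContDiffMapSupportedIn.of_support_subset φ.contDiff hφ
  have J_φK : J φK = jets s φ := by
    funext i
    exact DFunLike.coe_injective (ContDiffMapSupportedIn.structureMapLM_top_apply ℝ φK)
  rw [← J_φK, hL]
  rfl

theorem continuous_apply_translate (T : TestFn d →L[ℝ] F) (φ : TestFn d) :
    Continuous fun x => T (translate x φ) := by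
  refine continuous_iff_continuousAt.2 fun x => ?_
  obtain ⟨s, L, hL⟩ := exists_eq_jets T
    ((isCompact_closedBall (-x) 1).add φ.hasCompactSupport.isCompact)
  refine (L.continuous.comp (continuous_jets_translate s φ)).continuousAt.congr ?_
  filter_upwards [Metric.closedBall_mem_nhds x one_pos] with a ha
  have support_subset : Function.support (translate a φ) ⊆
      Metric.closedBall (-x) 1 + tsupport φ := by
    rw [← neg_neg a]
    exact (support_translate_neg_subset φ (-a)).trans <|
      Set.add_subset_add (Set.singleton_subset_iff.2 (by simpa [dist_neg_neg] using ha))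
        (subset_tsupport φ)
  exact (hL _ support_subset).symm

theorem integral_smul_apply_translate (T : TestFn d →L[ℝ] F) (φ ψ : TestFn d) :
    ∫ x, φ x • T (translate (-x) ψ) = T (testConvolution φ ψ) := by
  obtain ⟨s, L, hL⟩ := exists_eq_jets T
    (φ.hasCompactSupport.isCompact.add ψ.hasCompactSupport.isCompact)
  have support_subset {x : Eucl d} (hx : φ x ≠ 0) :
      Function.support (translate (-x) ψ) ⊆ tsupport φ + tsupport ψ :=
    (support_translate_neg_subset ψ x).trans <| Set.add_subset_add
      (Set.singleton_subset_iff.2 (subset_tsupport φ hx)) (subset_tsupport ψ)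
  have hint : Integrable fun x => φ x • jets s (translate (-x) ψ) :=
    integrable_testFn_smul ((continuous_jets_translate s ψ).comp continuous_neg) φ
  calc ∫ x, φ x • T (translate (-x) ψ)
      = ∫ x, L (φ x • jets s (translate (-x) ψ)) := by
        refine integral_congr_ae (.of_forall fun x => ?_)
        by_cases hx : φ x = 0
        · simp [hx]
        · simp only [map_smul, hL _ (support_subset hx)]
    _ = L (jets s (testConvolution φ ψ)) := by
        rw [L.integral_comp_comm hint, integral_smul_jets_translate]
    _ = T (testConvolution φ ψ) :=
        (hL _ ((support_testConvolution_subset φ ψ).trans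
          (Set.add_subset_add (subset_tsupport φ) (subset_tsupport ψ)))).symm

theorem integral_smul_apply_translate_comm (T : TestFn d →L[ℝ] F) (φ ψ : TestFn d) :
    ∫ x, φ x • T (translate (-x) ψ) = ∫ x, ψ x • T (translate (-x) φ) := by
  rw [integral_smul_apply_translate, integral_smul_apply_translate, testConvolution_comm]

end Jet

section Smoothing

open scoped Convolution

variable {d : ℕ}

theorem exists_isUnit_integral_testFn_smul {B : Type*} [NormedRing B] [NormedAlgebra ℝ B]
    [CompleteSpace B] {ρ : Eucl d → B} (hρ : Continuous ρ) (hρ0 : ρ 0 = 1) :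
    ∃ φ : TestFn d, IsUnit (∫ x, φ x • ρ x) := by
  obtain ⟨δ, hδ, hρδ⟩ := Metric.continuous_iff.1 (hρ.comp continuous_neg) 0 (1 / 2) (by norm_num)
  let β : ContDiffBump (0 : Eucl d) := ⟨δ / 2, δ, half_pos hδ, half_lt_self hδ⟩
  let φ : TestFn d :=
    ⟨β.normed volume, β.contDiff_normed, β.hasCompactSupport_normed, Set.subset_univ _⟩
  have average_eq :
      (β.normed volume ⋆[ContinuousLinearMap.lsmul ℝ ℝ, volume] (ρ ∘ Neg.neg)) 0 =
        ∫ x, φ x • ρ x := by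
    simp only [convolution_def, Function.comp_apply, zero_sub, neg_neg]
    rfl
  have dist_le : dist (∫ x, φ x • ρ x) 1 ≤ 1 / 2 := by
    simpa only [← average_eq, Function.comp_apply, neg_zero, hρ0] using
      β.dist_normed_convolution_le (hρ.comp continuous_neg).aestronglyMeasurable
        fun x hx => (hρδ x hx).le
  rw [dist_comm, dist_eq_norm] at dist_le
  exact ⟨φ, by simpa using isUnit_one_sub_of_norm_lt_one (dist_le.trans_lt one_half_lt_one)⟩

theorem exists_integral_testFn_smul_addChar_apply_eq {F : Type*} [NormedAddCommGroup F]
    [NormedSpace ℂ F] [CompleteSpace F] {ρ : AddChar (Eucl d) (F →L[ℂ] F)} (hρ : Continuous ρ)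
    (v : F) : ∃ (φ : TestFn d) (w : F), ∫ x, φ x • ρ x w = v := by
  obtain ⟨φ, U, hU⟩ := exists_isUnit_integral_testFn_smul hρ ρ.map_zero_eq_one
  refine ⟨φ, U.inv v, ?_⟩
  calc ∫ x, φ x • ρ x (U.inv v)
      = (∫ x, φ x • ρ x) (U.inv v) :=
        ((ContinuousLinearMap.apply ℂ F (U.inv v)).integral_comp_comm
          (integrable_testFn_smul hρ φ))
    _ = v := by
        rw [← hU]
        exact DFunLike.congr_fun U.val_inv v

end Smoothing

section Distribution

variable {d : ℕ}

/-- The distributions with the topology of pointwise convergence on test functions, for which the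
orbit maps of translation are easily seen to be continuous. -/
abbrev WeakDistr (d : ℕ) : Type := TestFn d →Lₚₜ[ℝ] ℂ

instance : ContinuousSMul ℂ (WeakDistr d) where
  continuous_smul := PointwiseConvergenceCLM.continuous_of_continuous_eval fun φ =>
    continuous_fst.smul ((continuous_eval_const (F := WeakDistr d) φ).comp continuous_snd)

/-- The linear map forgetting the topology of compact convergence. -/
def toWeakDistr (d : ℕ) : Distr d →ₗ[ℂ] WeakDistr d where
  toFun T := { toLinearMap := T.toLinearMap, cont := T.continuous }
  map_add' _ _ := rfl
  map_smul' _ _ := rfl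

theorem toWeakDistr_apply (T : Distr d) (φ : TestFn d) : toWeakDistr d T φ = T φ := rfl

/-- The translation action `(τ_x T){φ} = T{φ(· - x)}` on distributions. -/
noncomputable def distrTranslation (d : ℕ) : AddChar (Eucl d) (Module.End ℂ (WeakDistr d)) where
  toFun x :=
    { toFun := PointwiseConvergenceCLM.precomp ℂ (translate (-x))
      map_add' _ _ := rfl
      map_smul' _ _ := rfl }
  map_zero_eq_one' := by
    ext T φ
    refine congrArg T ?_
    ext x
    simp [translate_apply]
  map_add_eq_mul' x y := by
    ext T φ
    refine congrArg T ?_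
    ext z
    simp [translate_apply, add_assoc]

theorem distrTranslation_apply_apply (x : Eucl d) (T : WeakDistr d) (φ : TestFn d) :
    distrTranslation d x T φ = T (translate (-x) φ) := rfl

theorem mem_continuousVectors_distrTranslation (T : WeakDistr d) :
    T ∈ continuousVectors (distrTranslation d) :=
  mem_continuousVectors.2 <| PointwiseConvergenceCLM.continuous_of_continuous_eval fun φ =>
    (continuous_apply_translate T φ).comp continuous_neg

theorem distrTranslation_sub_one_pow_toWeakDistr (h : Eucl d) (m : ℕ) (T : Distr d) :
    ((distrTranslation d h - 1) ^ m) (toWeakDistr d T) = toWeakDistr d (distrDiff h m T) := by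
  ext φ
  rw [sub_one_pow_apply_eq_sum, toWeakDistr_apply, distrDiff_apply, testDiff]
  simp [distrTranslation_apply_apply, toWeakDistr_apply, Nat.cast_smul_eq_nsmul]

/-- The regular distribution `φ ↦ ∫ φ f` of a continuous function `f`. -/
noncomputable def regularDistr (f : C(Eucl d, ℂ)) : WeakDistr d :=
  let T : TestFn d →L[ℝ] ℂ :=
    TestFunction.integralAgainstBilinCLM (ContinuousLinearMap.lsmul ℝ ℝ) volume f
  { toLinearMap := T.toLinearMap, cont := T.continuous }

theorem regularDistr_apply (f : C(Eucl d, ℂ)) (φ : TestFn d) :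
    regularDistr f φ = ∫ x, φ x • f x :=
  TestFunction.integralAgainstBilinCLM_eq_integral
    (f.continuous.locallyIntegrable.locallyIntegrableOn _)

theorem regularDistr_add (f g : C(Eucl d, ℂ)) :
    regularDistr (f + g) = regularDistr f + regularDistr g := by
  ext φ
  simp only [add_apply, regularDistr_apply, ContinuousMap.add_apply, smul_add]
  exact integral_add (integrable_testFn_smul f.continuous φ)
    (integrable_testFn_smul g.continuous φ)

theorem regularDistr_smul (c : ℂ) (f : C(Eucl d, ℂ)) :
    regularDistr (c • f) = c • regularDistr f := by
  ext φ
  simp only [smul_apply, regularDistr_apply, ContinuousMap.smul_apply, smul_comm _ c]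
  exact integral_smul c _

theorem regularDistr_translation (x : Eucl d) (f : C(Eucl d, ℂ)) :
    regularDistr (translation (Eucl d) ℂ x f) = distrTranslation d x (regularDistr f) := by
  ext φ
  rw [distrTranslation_apply_apply, regularDistr_apply, regularDistr_apply,
    ← integral_add_right_eq_self _ (-x)]
  simp [translate_apply, translation_apply_apply]

theorem isExpPolyDistr_iff_exists_regularDistr {T : Distr d} :
    IsExpPolyDistr T ↔ ∃ g : C(Eucl d, ℂ), IsExpPoly g ∧ toWeakDistr d T = regularDistr g := by
  have regularDistr_apply_eq_mul (g : C(Eucl d, ℂ)) (φ : TestFn d) :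
      regularDistr g φ = ∫ x, (φ x : ℂ) * g x := by
    simp only [regularDistr_apply, Complex.real_smul]
  constructor
  · rintro ⟨g, hg, hT⟩
    refine ⟨⟨g, hg.continuous⟩, hg, ?_⟩
    ext φ
    rw [regularDistr_apply_eq_mul]
    exact hT φ
  · rintro ⟨g, hg, hT⟩
    refine ⟨g, hg, fun φ => ?_⟩
    rw [← regularDistr_apply_eq_mul, ← hT, toWeakDistr_apply]

/-- Evaluation at a test function. -/
noncomputable def distrEval (φ : TestFn d) : WeakDistr d →ₗ[ℂ] ℂ where
  toFun T := T φ
  map_add' _ _ := rfl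
  map_smul' _ _ := rfl

theorem exists_regularDistr_eq_of_mem_finiteVectors {T : WeakDistr d}
    (hT : T ∈ finiteVectors (distrTranslation d)) :
    ∃ g : C(Eucl d, ℂ), IsExpPoly g ∧ T = regularDistr g := by
  obtain ⟨n, ρ, e, hρ, he, v, rfl⟩ :=
    exists_continuous_addChar_of_mem_finiteVectors hT (mem_continuousVectors_distrTranslation T)
  obtain ⟨φ, w, hw⟩ := exists_integral_testFn_smul_addChar_apply_eq hρ v
  have coefficient_eq (ψ : TestFn d) (x : Eucl d) :
      (distrEval ψ ∘ₗ e) (ρ x w) = e w (translate (-x) ψ) :=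
    DFunLike.congr_fun (he x w) ψ
  have hg : IsExpPoly fun x => e w (translate (-x) φ) := by
    simpa only [coefficient_eq] using isExpPoly_coefficient hρ (distrEval φ ∘ₗ e) w
  let g : C(Eucl d, ℂ) := ⟨_, hg.continuous⟩
  refine ⟨g, hg, ?_⟩
  ext ψ
  let l : (Fin n → ℂ) →L[ℂ] ℂ := (distrEval ψ ∘ₗ e).toContinuousLinearMap
  calc e v ψ = l (∫ x, φ x • ρ x w) := by rw [hw]; rfl
    _ = ∫ x, φ x • l (ρ x w) := by
        rw [← l.integral_comp_comm (integrable_testFn_smul (by fun_prop) φ)]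
        simp only [map_real_smul l l.continuous]
    _ = ∫ x, φ x • e w (translate (-x) ψ) := by simp only [← coefficient_eq]; rfl
    _ = ∫ x, ψ x • e w (translate (-x) φ) := integral_smul_apply_translate_comm (e w) φ ψ
    _ = regularDistr g ψ := (regularDistr_apply g ψ).symm

theorem toWeakDistr_mem_finiteVectors_iff {T : Distr d} :
    toWeakDistr d T ∈ finiteVectors (distrTranslation d) ↔ IsExpPolyDistr T := by
  rw [isExpPolyDistr_iff_exists_regularDistr]
  refine ⟨exists_regularDistr_eq_of_mem_finiteVectors, ?_⟩
  rintro ⟨g, hg, hT⟩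
  let Λ : C(Eucl d, ℂ) →ₗ[ℂ] WeakDistr d :=
    { toFun := regularDistr, map_add' := regularDistr_add, map_smul' := regularDistr_smul }
  rw [hT]
  exact map_mem_finiteVectors (Λ := Λ) regularDistr_translation hg.mem_finiteVectors_translation

end Distribution

end ExpPolyDiff

theorem mainTheorem1 (d t : ℕ) (h : Fin t → ExpPolyDiff.Eucl d)
    (hdense : Dense (AddSubgroup.closure (Set.range h) : Set (ExpPolyDiff.Eucl d)))
    (m : Fin t → ℕ) :
    (∀ f : C(ExpPolyDiff.Eucl d, ℂ),
      (∀ k : Fin t, ExpPolyDiff.IsExpPoly (ExpPolyDiff.funDiff (h k) (m k) f)) →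
        ExpPolyDiff.IsExpPoly f) ∧
    (∀ T : ExpPolyDiff.Distr d,
      (∀ k : Fin t, ExpPolyDiff.IsExpPolyDistr (ExpPolyDiff.distrDiff (h k) (m k) T)) →
        ExpPolyDiff.IsExpPolyDistr T) := by
  refine ⟨fun f hf => ?_, fun T hT => ?_⟩
  · refine ExpPolyDiff.mem_finiteVectors_translation_iff.1 ?_
    refine ExpPolyDiff.mem_finiteVectors_of_sub_one_pow_mem hdense
      (ExpPolyDiff.mem_continuousVectors_translation f) (m := m) fun k => ?_
    rw [ExpPolyDiff.mem_finiteVectors_translation_iff, ExpPolyDiff.translation_sub_one_pow_apply,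
      ← ExpPolyDiff.funDiff_eq_iterate]
    exact hf k
  · refine ExpPolyDiff.toWeakDistr_mem_finiteVectors_iff.1 ?_
    refine ExpPolyDiff.mem_finiteVectors_of_sub_one_pow_mem hdense
      (ExpPolyDiff.mem_continuousVectors_distrTranslation _) (m := m) fun k => ?_
    rw [ExpPolyDiff.distrTranslation_sub_one_pow_toWeakDistr]
    exact ExpPolyDiff.toWeakDistr_mem_finiteVectors_iff.2 (hT k)
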